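/- Let $\mathcal M$ be the topological group of real Möbius transformations $z\mapsto (az+b)/(cz+d)$, $a,b,c,d\in\mathbb R$, $ad-bc>0$, acting on the hyperbolic upper half-plane $\mathbb H$ (with the topology of uniform convergence in the chordal metric on $\overline{\mathbb C}=\mathbb C\cup\{\infty\}$), and let $\overline{\mathbb R}=\mathbb R\cup\{\infty\}\subset\overline{\mathbb C}$. Let $\mathcal F\subset\mathcal M$ be finite and let $S$ be the semigroup generated by $\mathcal F$, i.e. the set of all compositions $f_1\cdots f_n$ with $n\ge 1$ and $f_i\in\mathcal F$. Suppose that $S$ is semidiscrete, i.e. that the identity is not an accumulation point of $S$ in $\mathcal M$. Let $\Lambda^-(S)$ be the backward limit set of $S$, i.e. the set of points of $\overline{\mathbb R}$ at which the set $\{g^{-1}(w): g\in S\}$ accumulates, where $w\in\mathbb H$ (it does not depend on $w$), and suppose that $|\Lambda^-(S)|\neq 1$. A composition sequence generated by $\mathcal F$ is a sequence $F_n=f_1\cdots f_n$ with all $f_i\in\mathcal F$ (and $F_0$ the identity). A sequence $(F_n)$ in $\mathcal M$ is escaping if, for some $w\in\mathbb H$, the sequence $(F_n(w))$ does not accumulate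 in $\mathbb H$; an escaping sequence converges ideally if, for some $w\in\mathbb H$, the sequence $(F_n(w))$ converges in $\overline{\mathbb C}$ to a point of $\overline{\mathbb R}$ (neither notion depends on the choice of $w$). Then the following statements are equivalent: (i) every composition sequence generated by $\mathcal F$ that is an escaping sequence converges ideally; (ii) $S$ is not a cocompact Fuchsian group, i.e. $S$ is not a discrete subgroup of $\mathcal M$ with compact quotient $\mathbb H/S$. -/

import Mathlib

open Set Filter Topology UpperHalfPlane
open scoped MatrixGroups Pointwise

namespace MoebiusSemigroup

/-- The group `𝓜` of real Moebius transformations `z ↦ (az + b)/(cz + d)`, with `a, b, c, d` real and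
`ad - bc > 0`, that is, of the conformal isometries of the hyperbolic plane `ℍ`. Scaling the
coefficients so that `ad - bc = 1`, this is `SL(2, ℝ)` modulo `±1`. Its topology is the quotient
topology, which is the topology of uniform convergence for the chordal metric on the Riemann
sphere. -/
abbrev MoebiusGroup : Type := PSL(2, ℝ)

/-- The action of real Moebius transformations on the hyperbolic plane. -/
noncomputable instance : MulAction MoebiusGroup ℍ :=
  MulAction.compHom ℍ
    (Matrix.ProjectiveSpecialLinearGroup.toPGL : MoebiusGroup →* PGL(2, ℝ))

theorem mk_smul (A : SL(2, ℝ)) (z : ℍ) : ((A : MoebiusGroup) • z) = A • z := rfl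

/-- The class of the matrix `!![a, b; c, d]` acts as `z ↦ (az + b)/(cz + d)`. -/
theorem coe_mk_smul (A : SL(2, ℝ)) (z : ℍ) :
    (((A : MoebiusGroup) • z : ℍ) : ℂ) =
      ((A 0 0 : ℂ) * z + (A 0 1 : ℂ)) / ((A 1 0 : ℂ) * z + (A 1 1 : ℂ)) := by
  rw [mk_smul, UpperHalfPlane.coe_specialLinearGroup_apply]
  simp

/-- A point of the hyperbolic plane, seen in the extended complex plane `ℂ ∪ {∞}`. The topology of
the one-point compactification is that of the chordal metric. -/
def planePoint (z : ℍ) : OnePoint ℂ := ((z : ℂ) : OnePoint ℂ)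

/-- A point of the extended real line `ℝ ∪ {∞}`, seen in the extended complex plane. -/
def idealPoint (x : OnePoint ℝ) : OnePoint ℂ := OnePoint.map (fun t : ℝ => (t : ℂ)) x

/-- `F 0, F 1, F 2, …` is a composition sequence generated by `𝓕`: `F 0` is the identity and
`F n = f₁ ⋯ fₙ` with all `fᵢ` in `𝓕`. -/
def IsCompositionSequence (𝓕 : Set MoebiusGroup) (F : ℕ → MoebiusGroup) : Prop :=
  F 0 = 1 ∧ ∀ n, ∃ f ∈ 𝓕, F (n + 1) = F n * f

/-- A sequence `F` of Moebius transformations is an escaping sequence if, for some `w` in `ℍ`,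
the sequence `F n (w)` does not accumulate at any point of `ℍ`. -/
def IsEscaping (F : ℕ → MoebiusGroup) : Prop :=
  ∃ w : ℍ, ∀ z : ℍ, ¬ MapClusterPt z atTop (fun n => F n • w)

/-- The sequence `F` converges ideally to the point `p` of the extended real line: it is escaping,
and `F n (w)` converges to `p` in the extended complex plane for some point `w` of `ℍ`
(equivalently, for every point `w` of `ℍ`). -/
def ConvergesIdeallyTo (F : ℕ → MoebiusGroup) (p : OnePoint ℝ) : Prop :=
  IsEscaping F ∧ ∃ w : ℍ, Tendsto (fun n => planePoint (F n • w)) atTop (𝓝 (idealPoint p))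

/-- The sequence `F` converges ideally to some point of the extended real line. -/
def ConvergesIdeally (F : ℕ → MoebiusGroup) : Prop :=
  ∃ p : OnePoint ℝ, ConvergesIdeallyTo F p

/-- The forward limit set of a set `T` of Moebius transformations: the points of the extended real
line at which the orbit `{g(w) : g ∈ T}` of a point `w` of `ℍ` accumulates. It does not depend on
the choice of `w`. -/
def forwardLimitSet (T : Set MoebiusGroup) : Set (OnePoint ℝ) :=
  {x | ∃ w : ℍ, AccPt (idealPoint x) (𝓟 ((fun g : MoebiusGroup => planePoint (g • w)) '' T))}

/-- The backward limit set of `T`: the forward limit set of the set of inverses of elements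
of `T`. -/
def backwardLimitSet (T : Set MoebiusGroup) : Set (OnePoint ℝ) :=
  forwardLimitSet T⁻¹

/-- A semigroup of Moebius transformations is semidiscrete if the identity is not an accumulation
point of it. -/
def IsSemidiscrete (S : Subsemigroup MoebiusGroup) : Prop :=
  ¬ AccPt (1 : MoebiusGroup) (𝓟 (S : Set MoebiusGroup))

/-- `S` is a cocompact Fuchsian group: it is a subgroup `G` of the group of Moebius transformations
which is discrete and for which the quotient space `ℍ / G` is compact. -/
def IsCocompactFuchsianGroup (S : Subsemigroup MoebiusGroup) : Prop :=
  ∃ G : Subgroup MoebiusGroup, (G : Set MoebiusGroup) = S ∧ DiscreteTopology G ∧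
    CompactSpace (Quotient (MulAction.orbitRel G ℍ))

end MoebiusSemigroup

namespace MoebiusSemigroup

/-! Write S¹ for S together with the identity.

Suppose S is not a cocompact Fuchsian group. If S¹w were D-dense for some D, any product could be
returned to a fixed compact set of isometries by multiplying by a further element of S¹; recurrence
and semidiscreteness would then give inverses in S, making S a discrete cocompact group
(`isCocompactFuchsianGroup_of_isOrbitDense`). So there are points arbitrarily far from S¹w. Moving
an almost nearest orbit point back to w and passing to an ideal limit, S¹w misses a horoball H
(`exists_horoball`), which an isometry k places at infinity.

For a composition sequence, F_m⁻¹F_n lies in S¹ when m ≤ n, so the tail of F_n(w) from m on misses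
F_m(H), and also F_m B₀⁻¹(H) for each B₀ in S. Since the backward limit set is not a singleton, some
B₀⁻¹ moves the base point of H (`encard_backwardLimitSet_eq_one`). If the escaping path oscillated
across a real interval, its bounded steps would bring it into a cone at each interior point,
arbitrarily low, and hence into any horoball based there. So no missed horoball is based in the
interval. But when the path is low near the midpoint, one of the two base points above is close to
it, a contradiction (`not_oscillates`).

Conversely, for a cocompact group take points of ℍ that descend to the real line while oscillating,
with bounded steps. Nearby orbit points differ by finitely many group elements; spelling these as
words in the generators gives an escaping composition sequence that does not converge. -/

theorem exists_lift (g : MoebiusGroup) : ∃ A : SL(2, ℝ), (A : MoebiusGroup) = g :=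
  QuotientGroup.mk_surjective g

/-! ### Proper isometric action and recurrence. -/

instance : IsIsometricSMul MoebiusGroup ℍ where
  isometry_smul g := by
    obtain ⟨A, rfl⟩ := exists_lift g
    exact isometry_smul ℍ A

theorem dist_inv_smul_left (g : MoebiusGroup) (z w : ℍ) : dist (g⁻¹ • z) w = dist z (g • w) := by
  rw [← dist_smul g, smul_inv_smul]

theorem isCompact_setOf_dist_smul_le (w : ℍ) (D : ℝ) :
    IsCompact {g : MoebiusGroup | dist (g • w) w ≤ D} := by
  have h := ProperSMul.isCompact_setOfPred_inter_nonempty (G := SL(2, ℝ)) (X := ℍ)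
    (isCompact_singleton (x := w)) (isCompact_closedBall w D)
  convert h.image (f := ((↑) : SL(2, ℝ) → MoebiusGroup)) continuous_quotient_mk' using 1
  ext g
  constructor
  · intro hg
    obtain ⟨A, rfl⟩ := exists_lift g
    refine ⟨A, ?_, rfl⟩
    simpa [← mk_smul] using hg
  · rintro ⟨A, hA, rfl⟩
    simpa [← mk_smul] using hA

/-- Two terms of the sequence close to a common cluster point have quotient close to the identity.
-/
theorem exists_lt_inv_mul_mem {G : Type*} [Group G] [TopologicalSpace G] [IsTopologicalGroup G]
    {K : Set G} (hK : IsCompact K) {h : ℕ → G} (hh : ∀ n, h n ∈ K) {U : Set G} (hU : U ∈ 𝓝 (1 : G)) :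
    ∃ k l, k < l ∧ (h k)⁻¹ * h l ∈ U := by
  obtain ⟨a, -, ha⟩ := hK.exists_mapClusterPt_of_frequently (l := atTop) (f := h)
    (Frequently.of_forall hh)
  have hc : Tendsto (fun p : G × G => p.1⁻¹ * p.2) (𝓝 (a, a)) (𝓝 1) := by
    have : Continuous (fun p : G × G => p.1⁻¹ * p.2) := by fun_prop
    simpa using this.tendsto (a, a)
  have hV := hc hU
  rw [mem_map, nhds_prod_eq, mem_prod_self_iff] at hV
  obtain ⟨V, hV, hVU⟩ := hV
  have hf := mapClusterPt_iff_frequently.1 ha V hV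
  obtain ⟨k, -, hk⟩ := frequently_atTop.1 hf 0
  obtain ⟨l, hl, hl'⟩ := frequently_atTop.1 hf (k + 1)
  exact ⟨k, l, hl, hVU (mk_mem_prod hk hl')⟩

theorem IsSemidiscrete.exists_nhds {S : Subsemigroup MoebiusGroup} (hS : IsSemidiscrete S) :
    ∃ U ∈ 𝓝 (1 : MoebiusGroup), ∀ g ∈ U, g ∈ S → g = 1 := by
  simp only [IsSemidiscrete, accPt_iff_nhds, not_forall, not_exists, not_and, not_not] at hS
  obtain ⟨U, hU, h⟩ := hS
  exact ⟨U, hU, fun g hg hgS => h g ⟨hg, hgS⟩⟩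

/-- The union of a semigroup and the identity. -/
def withOne (S : Subsemigroup MoebiusGroup) : Submonoid MoebiusGroup where
  carrier := {g | g = 1 ∨ g ∈ S}
  one_mem' := Or.inl rfl
  mul_mem' := by
    rintro a b (rfl | ha) (rfl | hb)
    · simp
    · simpa using Or.inr hb
    · simpa using Or.inr ha
    · exact Or.inr (S.mul_mem ha hb)

theorem mem_withOne_of_mem {S : Subsemigroup MoebiusGroup} {g : MoebiusGroup} (h : g ∈ S) :
    g ∈ withOne S := Or.inr h

theorem mul_mem_of_mem_withOne {S : Subsemigroup MoebiusGroup} {g h : MoebiusGroup} (hg : g ∈ S)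
    (hh : h ∈ withOne S) : g * h ∈ S := by
  rcases hh with rfl | hh
  · simpa using hg
  · exact S.mul_mem hg hh

theorem mul_mem_of_withOne_mem {S : Subsemigroup MoebiusGroup} {g h : MoebiusGroup}
    (hg : g ∈ withOne S) (hh : h ∈ S) : g * h ∈ S := by
  rcases hg with rfl | hg
  · simpa using hh
  · exact S.mul_mem hg hh

/-! ### Coarsely dense orbits yield cocompact Fuchsian groups. -/

/-- The orbit of `w` under the semigroup and the identity is `D`-dense. -/
def IsOrbitDense (S : Subsemigroup MoebiusGroup) (w : ℍ) (D : ℝ) : Prop :=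
  ∀ z : ℍ, ∃ g ∈ withOne S, dist z (g • w) ≤ D

/-- If the orbit is coarsely dense then any chain of elements can be brought back to a bounded
region, and semidiscreteness turns such a recurrent chain into an inverse. -/
theorem inv_mem_of_isOrbitDense {S : Subsemigroup MoebiusGroup} (hS : IsSemidiscrete S) {w : ℍ}
    {D : ℝ} (hD : IsOrbitDense S w D) {g : MoebiusGroup} (hg : g ∈ S) : g⁻¹ ∈ S := by
  obtain ⟨U, hU, hU1⟩ := hS.exists_nhds
  have hnext : ∀ h : MoebiusGroup, ∃ s ∈ withOne S, dist ((h * g * s) • w) w ≤ D := by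
    intro h
    obtain ⟨s, hs, hd⟩ := hD ((h * g)⁻¹ • w)
    refine ⟨s, hs, ?_⟩
    rwa [mul_smul, dist_comm, ← dist_inv_smul_left]
  choose s hsS hsd using hnext
  -- Each step multiplies by `g` before returning to the compact set, so every quotient of a later
  -- term by an earlier one starts with `g`.
  let h : ℕ → MoebiusGroup := fun n => Nat.rec (g * s 1) (fun _ a => a * g * s a) n
  have hsucc : ∀ n, h (n + 1) = h n * g * s (h n) := fun n => rfl
  have hbd : ∀ n, h n ∈ {g : MoebiusGroup | dist (g • w) w ≤ D} := by
    intro n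
    cases n with
    | zero =>
      have := hsd 1
      rwa [one_mul] at this
    | succ n => exact hsd (h n)
  have hstep : ∀ k l, k < l → ∃ t ∈ withOne S, (h k)⁻¹ * h l = g * t := by
    intro k l hkl
    induction l, hkl using Nat.le_induction with
    | base => exact ⟨s (h k), hsS _, by rw [hsucc]; group⟩
    | succ l hl ih =>
      obtain ⟨t, ht, he⟩ := ih
      refine ⟨t * g * s (h l), mul_mem (mul_mem ht (mem_withOne_of_mem hg)) (hsS _), ?_⟩
      rw [hsucc, ← mul_assoc, ← mul_assoc, he]
      group
  obtain ⟨k, l, hkl, hmem⟩ := exists_lt_inv_mul_mem (isCompact_setOf_dist_smul_le w D) hbd hU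
  obtain ⟨t, ht, he⟩ := hstep k l hkl
  have h1 : g * t = 1 := hU1 _ (he ▸ hmem) (mul_mem_of_mem_withOne hg ht)
  rw [inv_eq_of_mul_eq_one_right h1]
  rcases ht with rfl | ht
  · rw [mul_one] at h1
    rwa [← h1]
  · exact ht

theorem isCocompactFuchsianGroup_of_isOrbitDense {S : Subsemigroup MoebiusGroup}
    (hS : IsSemidiscrete S) (hne : (S : Set MoebiusGroup).Nonempty) {w : ℍ} {D : ℝ}
    (hD : IsOrbitDense S w D) : IsCocompactFuchsianGroup S := by
  have hinv : ∀ g ∈ S, g⁻¹ ∈ S := fun g hg => inv_mem_of_isOrbitDense hS hD hg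
  obtain ⟨g₀, hg₀⟩ := hne
  have hone : (1 : MoebiusGroup) ∈ S := by
    have := S.mul_mem hg₀ (hinv _ hg₀)
    rwa [mul_inv_cancel] at this
  let G : Subgroup MoebiusGroup :=
    { carrier := S, mul_mem' := fun ha hb => S.mul_mem ha hb, one_mem' := hone, inv_mem' := fun {x} hx => hinv x hx }
  refine ⟨G, rfl, ?_, ?_⟩
  · obtain ⟨U, hU, hU1⟩ := hS.exists_nhds
    apply discreteTopology_of_isOpen_singleton_one
    rw [isOpen_singleton_iff_nhds_eq_pure, eq_comm]
    refine (pure_le_nhds _).antisymm ?_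
    intro s hs
    have h1 : (1 : G) ∈ s := by simpa using hs
    have : (Subtype.val : G → MoebiusGroup) ⁻¹' U ∈ 𝓝 (1 : G) :=
      continuous_subtype_val.continuousAt (by simpa using hU)
    filter_upwards [this] with x hx
    have : x = 1 := Subtype.ext (hU1 _ hx x.2)
    rwa [this]
  · rw [← isCompact_univ_iff]
    have hc := (isCompact_closedBall w D).image
      (f := (Quotient.mk'' : ℍ → Quotient (MulAction.orbitRel G ℍ))) continuous_quotient_mk'
    convert hc
    symm
    rw [eq_univ_iff_forall]
    intro q
    induction q using Quotient.inductionOn' with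
    | h z =>
      obtain ⟨g, hg, hd⟩ := hD z
      have hgS : g ∈ S := by
        rcases hg with rfl | hg
        · exact hone
        · exact hg
      refine ⟨g⁻¹ • z, ?_, ?_⟩
      · rwa [Metric.mem_closedBall, dist_inv_smul_left]
      · apply Quotient.sound'
        exact ⟨(⟨g⁻¹, hinv g hgS⟩ : G), rfl⟩

/-! ### Horoballs missed by orbits that are not coarsely dense. -/

theorem coe_sl_smul (A : SL(2, ℝ)) (z : ℍ) :
    ((A • z : ℍ) : ℂ) = ((A 0 0 : ℂ) * z + (A 0 1 : ℂ)) / ((A 1 0 : ℂ) * z + (A 1 1 : ℂ)) := by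
  rw [← mk_smul, coe_mk_smul]

/-- The isometry `z ↦ -1 / (z - x)`, which takes `x` to infinity. -/
def toInfty (x : ℝ) : SL(2, ℝ) := ⟨!![0, -1; 1, -x], by simp [Matrix.det_fin_two]⟩

theorem coe_toInfty_smul (x : ℝ) (z : ℍ) :
    ((toInfty x • z : ℍ) : ℂ) = -1 / ((z : ℂ) - x) := by
  rw [coe_sl_smul]
  simp [toInfty, sub_eq_add_neg]

theorem tendsto_norm_toInfty_smul {ι : Type*} {l : Filter ι} {u : ι → ℍ} {x : ℝ}
    (hu : Tendsto (fun n => (u n : ℂ)) l (𝓝 (x : ℂ))) :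
    Tendsto (fun n => ‖((toInfty x • u n : ℍ) : ℂ)‖) l atTop := by
  simp_rw [coe_toInfty_smul, norm_div, norm_neg, norm_one, one_div]
  refine tendsto_inv_nhdsGT_zero.comp ?_
  rw [tendsto_nhdsWithin_iff]
  constructor
  · simpa using (hu.sub_const (x : ℂ)).norm
  · refine Eventually.of_forall fun n => ?_
    have : (u n : ℂ) - x ≠ 0 := fun h => by
      have := congrArg Complex.im h
      simp only [Complex.sub_im, Complex.ofReal_im, sub_zero, Complex.zero_im] at this
      exact (u n).im_pos.ne' this
    simpa using this

theorem frequently_of_not_tendsto_norm {u : ℕ → ℂ} (h : ¬ Tendsto (fun n => ‖u n‖) atTop atTop) :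
    ∃ R, ∃ᶠ n in atTop, u n ∈ Metric.closedBall 0 R := by
  rw [tendsto_atTop] at h
  push Not at h
  obtain ⟨R, hR⟩ := h
  refine ⟨R, hR.mono fun n hn => ?_⟩
  simpa using hn.le

/-- A sequence leaving every bounded set of the hyperbolic plane has a subsequence which an
isometry takes to infinity. -/
theorem exists_smul_tendsto_norm {u : ℕ → ℍ} {w : ℍ}
    (hu : Tendsto (fun n => dist (u n) w) atTop atTop) :
    ∃ k : SL(2, ℝ), ∃ φ : ℕ → ℕ, Tendsto (fun n => ‖((k • u (φ n) : ℍ) : ℂ)‖) atTop atTop := by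
  by_cases hb : Tendsto (fun n => ‖(u n : ℂ)‖) atTop atTop
  · exact ⟨1, id, by simpa using hb⟩
  obtain ⟨R, hR⟩ := frequently_of_not_tendsto_norm hb
  obtain ⟨ζ, -, φ, hφ, hζ⟩ := tendsto_subseq_of_frequently_bounded Metric.isBounded_closedBall hR
  have him : Tendsto (fun n => (u (φ n)).im) atTop (𝓝 ζ.im) :=
    (Complex.continuous_im.tendsto ζ).comp hζ
  -- A limit with positive imaginary part would be a limit in ℍ, which the divergence of distances
  -- forbids.
  have h0 : ζ.im = 0 := by
    refine le_antisymm (not_lt.1 fun hpos => ?_)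
      (ge_of_tendsto' him fun n => (u (φ n)).im_pos.le)
    have ht : Tendsto (fun n => u (φ n)) atTop (𝓝 ⟨ζ, hpos⟩) := by
      rw [UpperHalfPlane.isEmbedding_coe.tendsto_nhds_iff]
      exact hζ
    exact not_tendsto_nhds_of_tendsto_atTop (hu.comp hφ.tendsto_atTop) _
      (ht.dist tendsto_const_nhds)
  have hre : (ζ.re : ℂ) = ζ := Complex.ext (by simp) (by simp [h0])
  refine ⟨toInfty ζ.re, φ, ?_⟩
  exact tendsto_norm_toInfty_smul (by rwa [hre])

theorem cosh_add_one_le (d : ℝ) : Real.cosh (d + 1) ≤ Real.exp 1 * Real.cosh d := by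
  rw [Real.cosh_eq, Real.cosh_eq, Real.exp_add, neg_add, Real.exp_add]
  have : Real.exp (-1) ≤ Real.exp 1 := Real.exp_le_exp.2 (by norm_num)
  nlinarith [Real.exp_pos (-d)]

/-- The limiting comparison of distances to `p` and `q` from points going to infinity. -/
theorem im_le_of_dist_le {v : ℕ → ℍ} (hv : Tendsto (fun n => ‖(v n : ℂ)‖) atTop atTop) {p q : ℍ}
    (h : ∀ n, dist (v n) q ≤ dist (v n) p + 1) : p.im ≤ Real.exp 1 * q.im := by
  -- The distance inequality in cosh form, multiplied by twice the height of `v n` and divided by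
  -- `‖v n‖ ^ 2`. The additive error 1 has become the factor e, and the limit reads 1 / Im q ≤ e /
  -- Im p.
  have key : ∀ᶠ n in atTop, (1 - ‖(q : ℂ)‖ * ‖(v n : ℂ)‖⁻¹) ^ 2 / q.im ≤
      Real.exp 1 * (2 * ‖(v n : ℂ)‖⁻¹ + (1 + ‖(p : ℂ)‖ * ‖(v n : ℂ)‖⁻¹) ^ 2 / p.im) := by
    filter_upwards [hv.eventually_ge_atTop (‖(q : ℂ)‖ + 1)] with n hn
    have ht : 0 < ‖(v n : ℂ)‖ := by linarith [norm_nonneg (q : ℂ)]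
    have h1 := (Real.cosh_le_cosh (x := dist (v n) q) (y := dist (v n) p + 1) |>.2 (by
      rw [abs_of_nonneg dist_nonneg,
        abs_of_nonneg (by positivity)]; exact h n)).trans
      (cosh_add_one_le (dist (v n) p))
    rw [cosh_dist, cosh_dist] at h1
    have hi := (v n).im_pos
    have hp := p.im_pos
    have hq := q.im_pos
    have him : (v n).im ≤ ‖(v n : ℂ)‖ := (le_abs_self _).trans (Complex.abs_im_le_norm _)
    have e1 : ‖(v n : ℂ)‖ - ‖(q : ℂ)‖ ≤ dist (v n : ℂ) q := by
      rw [dist_eq_norm]; exact norm_sub_norm_le _ _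
    have e2 : dist (v n : ℂ) p ≤ ‖(v n : ℂ)‖ + ‖(p : ℂ)‖ := by
      rw [dist_eq_norm]; exact norm_sub_le _ _
    have e1' : (‖(v n : ℂ)‖ - ‖(q : ℂ)‖) ^ 2 ≤ dist (v n : ℂ) q ^ 2 := by
      apply pow_le_pow_left₀ (by linarith) e1
    have e2' : dist (v n : ℂ) p ^ 2 ≤ (‖(v n : ℂ)‖ + ‖(p : ℂ)‖) ^ 2 :=
      pow_le_pow_left₀ dist_nonneg e2 2
    have h2 : dist (v n : ℂ) q ^ 2 / q.im ≤
        Real.exp 1 * (2 * (v n).im + dist (v n : ℂ) p ^ 2 / p.im) := by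
      have h3 := mul_le_mul_of_nonneg_left h1 (by positivity : 0 ≤ 2 * (v n).im)
      have e3 : 2 * (v n).im * (1 + dist (v n : ℂ) q ^ 2 / (2 * (v n).im * q.im)) =
          2 * (v n).im + dist (v n : ℂ) q ^ 2 / q.im := by field_simp
      have e4 : 2 * (v n).im * (Real.exp 1 * (1 + dist (v n : ℂ) p ^ 2 / (2 * (v n).im * p.im))) =
          Real.exp 1 * (2 * (v n).im + dist (v n : ℂ) p ^ 2 / p.im) := by field_simp
      rw [e3, e4] at h3
      linarith
    have h4 : (‖(v n : ℂ)‖ - ‖(q : ℂ)‖) ^ 2 / q.im ≤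
        Real.exp 1 * (2 * ‖(v n : ℂ)‖ + (‖(v n : ℂ)‖ + ‖(p : ℂ)‖) ^ 2 / p.im) :=
      calc _ ≤ _ := by gcongr
        _ ≤ _ := h2
        _ ≤ _ := by gcongr
    have h5 := mul_le_mul_of_nonneg_right h4 (by positivity : 0 ≤ (‖(v n : ℂ)‖⁻¹) ^ 2)
    calc _ = _ := ?_
      _ ≤ _ := h5
      _ = _ := ?_
    · field_simp
    · field_simp
  have hinv : Tendsto (fun n => ‖(v n : ℂ)‖⁻¹) atTop (𝓝 0) := tendsto_inv_atTop_zero.comp hv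
  have l1 : Tendsto (fun n => (1 - ‖(q : ℂ)‖ * ‖(v n : ℂ)‖⁻¹) ^ 2 / q.im) atTop
      (𝓝 ((1 - ‖(q : ℂ)‖ * 0) ^ 2 / q.im)) := (((hinv.const_mul _).const_sub _).pow 2).div_const _
  have l2 : Tendsto (fun n => Real.exp 1 * (2 * ‖(v n : ℂ)‖⁻¹ +
      (1 + ‖(p : ℂ)‖ * ‖(v n : ℂ)‖⁻¹) ^ 2 / p.im)) atTop
      (𝓝 (Real.exp 1 * (2 * 0 + (1 + ‖(p : ℂ)‖ * 0) ^ 2 / p.im))) :=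
    ((hinv.const_mul _).add ((((hinv.const_mul _).const_add _).pow 2).div_const _)).const_mul _
  have := le_of_tendsto_of_tendsto l1 l2 key
  have hp := p.im_pos
  have hq := q.im_pos
  simp only [mul_zero, sub_zero, one_pow, zero_add, add_zero] at this
  rw [mul_one_div, div_le_div_iff₀ hq hp] at this
  linarith

/-- If the orbit of `w` is not coarsely dense then, after an isometry taking a suitable ideal
point to infinity, the orbit misses a horoball at infinity. -/
theorem exists_horoball {S : Subsemigroup MoebiusGroup} {w : ℍ} (h : ∀ D, ¬ IsOrbitDense S w D) :
    ∃ k : SL(2, ℝ), ∃ c : ℝ, ∀ g ∈ withOne S, (k • g • w).im ≤ c := by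
  have h' : ∀ n : ℕ, ∃ u : ℍ, (n : ℝ) ≤ dist u w ∧
      ∀ g ∈ withOne S, dist u w ≤ dist u (g • w) + 1 := by
    intro n
    have hn := h n
    simp only [IsOrbitDense, not_forall, not_exists, not_and, not_le] at hn
    obtain ⟨z, hz⟩ := hn
    let s : Set ℍ := (fun g : MoebiusGroup => g • w) '' (withOne S : Set MoebiusGroup)
    have hs : s.Nonempty := ⟨_, 1, one_mem _, rfl⟩
    -- Pulling `z` back by an almost nearest `g₀` makes `w` almost nearest. No inverses in the
    -- semigroup are needed, since `g₀ * g` stays in `withOne S`.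
    obtain ⟨_, ⟨g₀, hg₀, rfl⟩, hlt⟩ := (Metric.infDist_lt_iff hs).1 (lt_add_one (Metric.infDist z s))
    refine ⟨g₀⁻¹ • z, ?_, fun g hg => ?_⟩
    · rw [dist_inv_smul_left]
      exact (hz _ hg₀).le
    · rw [dist_inv_smul_left, dist_inv_smul_left, ← mul_smul]
      have : Metric.infDist z s ≤ dist z ((g₀ * g) • w) :=
        Metric.infDist_le_dist_of_mem ⟨g₀ * g, mul_mem hg₀ hg, rfl⟩
      simp only at hlt
      linarith
  choose u hu1 hu2 using h'
  obtain ⟨k, φ, hk⟩ := exists_smul_tendsto_norm (u := u) (w := w)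
    (tendsto_atTop_mono hu1 tendsto_natCast_atTop_atTop)
  refine ⟨k, Real.exp 1 * (k • w).im, fun g hg => im_le_of_dist_le hk fun n => ?_⟩
  rw [dist_smul, dist_smul]
  exact hu2 _ g hg

/-! ### Matrix estimates for heights and for images of infinity. -/

theorem im_sl_smul (A : SL(2, ℝ)) (z : ℍ) :
    (A • z).im = z.im / Complex.normSq ((A 1 0 : ℂ) * z + A 1 1) := by
  simp only [MulAction.compHom_smul_def, im_smul_eq_div_normSq, Matrix.SpecialLinearGroup.det_mapGL,
    Units.val_one, abs_one, one_mul]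
  simp [denom]

theorem sl_det (A : SL(2, ℝ)) : A 0 0 * A 1 1 - A 0 1 * A 1 0 = 1 := by
  have := A.det_coe
  rwa [Matrix.det_fin_two] at this

theorem sl_denom_ne_zero (A : SL(2, ℝ)) (z : ℍ) : (A 1 0 : ℂ) * z + A 1 1 ≠ 0 := by
  intro h
  have h1 := congrArg Complex.im h
  have h2 := congrArg Complex.re h
  simp at h1 h2
  rcases h1 with h1 | h1
  · rw [h1] at h2
    have := sl_det A
    simp at h2
    simp [h1, h2] at this
  · exact z.im_pos.ne' h1

theorem im_sl_inv_smul (A : SL(2, ℝ)) (z : ℍ) :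
    (A⁻¹ • z).im = z.im / ((A 0 0 - A 1 0 * z.re) ^ 2 + (A 1 0 * z.im) ^ 2) := by
  rw [im_sl_smul, Complex.normSq_apply]
  simp [Matrix.SpecialLinearGroup.coe_inv, Matrix.adjugate_fin_two]
  ring_nf

/-- The image of infinity under `A` is close to `A z` if the lower left entry is not small. -/
theorem sq_sub_re_le {A : SL(2, ℝ)} (hA : 1 ≤ |A 1 0|) (z : ℍ) :
    (A 0 0 / A 1 0 - (A • z).re) ^ 2 ≤ (A • z).im / z.im := by
  have hc : (A 1 0 : ℂ) ≠ 0 := by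
    intro h
    have : A 1 0 = 0 := by exact_mod_cast h
    rw [this] at hA
    norm_num at hA
  have hd := sl_denom_ne_zero A z
  have hdet : (A 0 0 : ℂ) * A 1 1 - A 0 1 * A 1 0 = 1 := by exact_mod_cast sl_det A
  have h1 : ((A 0 0 / A 1 0 : ℝ) : ℂ) - (A • z : ℍ) =
      ((A 1 0 : ℂ) * ((A 1 0 : ℂ) * z + A 1 1))⁻¹ := by
    rw [coe_sl_smul]
    push_cast
    field_simp
    linear_combination hdet
  have h2 : (A 0 0 / A 1 0 - (A • z).re) ^ 2 ≤
      Complex.normSq (((A 0 0 / A 1 0 : ℝ) : ℂ) - (A • z : ℍ)) := by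
    rw [Complex.normSq_apply]
    simp only [Complex.sub_re, Complex.ofReal_re, coe_re]
    nlinarith [mul_self_nonneg (((A 0 0 / A 1 0 : ℝ) : ℂ) - (A • z : ℍ)).im]
  refine h2.trans ?_
  have hpos := Complex.normSq_pos.2 hd
  rw [h1, map_inv₀, map_mul, im_sl_smul, Complex.normSq_ofReal, div_right_comm, div_self z.im_pos.ne',
    one_div]
  have : 1 ≤ A 1 0 * A 1 0 := by
    rw [← abs_mul_abs_self]
    nlinarith
  gcongr
  nlinarith

theorem abs_re_sub_re_le {z w : ℍ} {C : ℝ} (h : dist z w ≤ C) :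
    |z.re - w.re| ≤ (Real.exp C - 1) * w.im := by
  have h1 := dist_coe_le z w
  rw [dist_eq_norm] at h1
  have h2 := (Complex.abs_re_le_norm ((z : ℂ) - w)).trans h1
  rw [Complex.sub_re, coe_re, coe_re] at h2
  have : Real.exp (dist z w) ≤ Real.exp C := Real.exp_le_exp.2 h
  nlinarith [w.im_pos]

/-! ### Escaping paths of bounded height and bounded steps do not oscillate. -/

section Path

variable {Q : ℕ → ℍ} {w : ℍ} {c C : ℝ}

/-- A sequence of points of bounded height that leaves every bounded set descends over bounded
intervals of the real line. -/
theorem eventually_im_lt (hesc : Tendsto (fun n => dist (Q n) w) atTop atTop)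
    (hc : ∀ n, (Q n).im ≤ c) (R : ℝ) {ε : ℝ} (hε : 0 < ε) :
    ∀ᶠ n in atTop, |(Q n).re| ≤ R → (Q n).im < ε := by
  -- The constant bounds the distance to `w` from any point of the box |Re| ≤ R, ε ≤ Im ≤ c.
  filter_upwards [hesc.eventually_gt_atTop ((R + c + ‖(w : ℂ)‖) / √(ε * w.im))] with n hn hR
  by_contra! hlow
  refine hn.not_ge ((dist_le_dist_coe_div_sqrt _ _).trans ?_)
  have hw := w.im_pos
  have h1 : dist (Q n : ℂ) w ≤ R + c + ‖(w : ℂ)‖ := by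
    rw [dist_eq_norm]
    refine (norm_sub_le _ _).trans ?_
    gcongr
    refine (Complex.norm_le_abs_re_add_abs_im _).trans ?_
    rw [coe_re, coe_im, abs_of_pos (Q n).im_pos]
    exact add_le_add hR (hc n)
  gcongr
  exact dist_nonneg.trans h1

/-- Without oscillation the real parts have no upcrossings, hence converge in `EReal`. At a finite
limit, `eventually_im_lt` forces the heights to 0. -/
theorem tendsto_or_oscillates (hesc : Tendsto (fun n => dist (Q n) w) atTop atTop)
    (hc : ∀ n, (Q n).im ≤ c) :
    (∃ x : ℝ, Tendsto (fun n => (Q n : ℂ)) atTop (𝓝 (x : ℂ))) ∨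
      Tendsto (fun n => ‖(Q n : ℂ)‖) atTop atTop ∨
      ∃ p q : ℝ, p < q ∧ (∃ᶠ n in atTop, (Q n).re < p) ∧ ∃ᶠ n in atTop, q < (Q n).re := by
  by_cases hosc : ∃ p q : ℝ, p < q ∧ (∃ᶠ n in atTop, (Q n).re < p) ∧ ∃ᶠ n in atTop, q < (Q n).re
  · exact Or.inr (Or.inr hosc)
  obtain ⟨l, hl⟩ := tendsto_of_no_upcrossings (f := atTop) (u := fun n => ((Q n).re : EReal))
    (dense_univ) (by
      rintro a - b - hab ⟨h1, h2⟩
      obtain ⟨q, hq1, hq2⟩ := EReal.lt_iff_exists_real_btwn.1 hab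
      obtain ⟨p, hp1, hp2⟩ := EReal.lt_iff_exists_real_btwn.1 hq1
      refine hosc ⟨p, q, EReal.coe_lt_coe_iff.1 hp2, h1.mono fun n hn => ?_, h2.mono fun n hn => ?_⟩
      · exact EReal.coe_lt_coe_iff.1 (hn.trans hp1)
      · exact EReal.coe_lt_coe_iff.1 (hq2.trans hn))
  have hle : ∀ n, |(Q n).re| ≤ ‖(Q n : ℂ)‖ := fun n => Complex.abs_re_le_norm (Q n : ℂ)
  induction l with
  | bot =>
    refine Or.inr (Or.inl (tendsto_atTop_mono hle ?_))
    exact tendsto_abs_atBot_atTop.comp (EReal.tendsto_coe_nhds_bot_iff.1 hl)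
  | top =>
    refine Or.inr (Or.inl (tendsto_atTop_mono hle ?_))
    exact tendsto_abs_atTop_atTop.comp (EReal.tendsto_coe_nhds_top_iff.1 hl)
  | coe x =>
    refine Or.inl ⟨x, ?_⟩
    have hre : Tendsto (fun n => (Q n).re) atTop (𝓝 x) := EReal.tendsto_coe.1 hl
    have him : Tendsto (fun n => (Q n).im) atTop (𝓝 0) := by
      refine Metric.tendsto_nhds.2 fun ε hε => ?_
      filter_upwards [eventually_im_lt hesc hc (|x| + 1) hε,
        hre.abs.eventually (gt_mem_nhds (lt_add_one |x|))] with n h1 h2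
      rw [Real.dist_eq, sub_zero, abs_of_pos (Q n).im_pos]
      exact h1 h2.le
    have := ((Complex.continuous_ofReal.tendsto x).comp hre).add
      (((Complex.continuous_ofReal.tendsto 0).comp him).mul_const Complex.I)
    simp only [Complex.ofReal_zero, zero_mul, add_zero] at this
    refine this.congr fun n => ?_
    exact Complex.re_add_im (Q n : ℂ)

variable {p q : ℝ}

/-- Take the last index before the path first passes to the right of `r`. The bounded step then
places the point in a cone with vertex `r`, whose aperture depends only on `C`. -/
theorem exists_crossing (hesc : Tendsto (fun n => dist (Q n) w) atTop atTop)
    (hc : ∀ n, (Q n).im ≤ c) (hstep : ∀ n, dist (Q (n + 1)) (Q n) ≤ C)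
    (hp : ∃ᶠ n in atTop, (Q n).re < p) (hq : ∃ᶠ n in atTop, q < (Q n).re) {r : ℝ} (hr : r ∈ Ioo p q)
    {ε : ℝ} (hε : 0 < ε) (N : ℕ) :
    ∃ n ≥ N, |(Q n).re - r| ≤ (Real.exp C - 1) * (Q n).im ∧ (Q n).im < ε := by
  have hC : 0 ≤ Real.exp C - 1 := by
    have := Real.add_one_le_exp C
    have := dist_nonneg.trans (hstep 0)
    linarith
  obtain ⟨N', hN'⟩ := eventually_atTop.1
    (eventually_im_lt hesc hc (|r| + (Real.exp C - 1) * c) hε)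
  obtain ⟨n₁, hn₁, h₁⟩ := frequently_atTop.1 hp (max N N')
  obtain ⟨n₂, hn₂, h₂⟩ := frequently_atTop.1 hq n₁
  have hex : ∃ n, n₁ ≤ n ∧ r < (Q n).re := ⟨n₂, hn₂, hr.2.trans h₂⟩
  classical
  obtain ⟨h3, h4⟩ := Nat.find_spec hex
  have hne : Nat.find hex ≠ n₁ := fun h => by
    rw [h] at h4
    exact lt_asymm (h₁.trans hr.1) h4
  obtain ⟨n, hn⟩ : ∃ n, Nat.find hex = n + 1 := Nat.exists_eq_succ_of_ne_zero (by omega)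
  have h5 : (Q n).re ≤ r := by
    by_contra! h
    exact Nat.find_min hex (m := n) (by omega) ⟨by omega, h⟩
  rw [hn] at h4
  have h6 := abs_re_sub_re_le (hstep n)
  have h7 : |(Q n).re - r| ≤ (Real.exp C - 1) * (Q n).im := by
    rw [abs_sub_comm, abs_of_nonneg (by linarith)]
    exact le_trans (by linarith [le_abs_self ((Q (n + 1)).re - (Q n).re)]) h6
  refine ⟨n, by omega, h7, hN' n (by omega) ?_⟩
  have h8 : (Real.exp C - 1) * (Q n).im ≤ (Real.exp C - 1) * c :=
    mul_le_mul_of_nonneg_left (hc n) hC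
  calc |(Q n).re| = |r + ((Q n).re - r)| := by ring_nf
    _ ≤ _ := (abs_add_le _ _).trans (by linarith)

/-- The base of a horoball missed by the tail of a path does not lie in an interval across which
the path oscillates. -/
theorem notMem_Ioo_of_im_inv_smul_le (hesc : Tendsto (fun n => dist (Q n) w) atTop atTop)
    (hc : ∀ n, (Q n).im ≤ c) (hstep : ∀ n, dist (Q (n + 1)) (Q n) ≤ C)
    (hp : ∃ᶠ n in atTop, (Q n).re < p) (hq : ∃ᶠ n in atTop, q < (Q n).re) {M : SL(2, ℝ)}
    (hM : M 1 0 ≠ 0) {m : ℕ} (hm : ∀ n ≥ m, (M⁻¹ • Q n).im ≤ c) : M 0 0 / M 1 0 ∉ Ioo p q := by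
  intro hr
  set K := Real.exp C - 1
  have hcpos : 0 < c := (Q 0).im_pos.trans_le (hc 0)
  have hM2 : 0 < M 1 0 ^ 2 := by positivity
  -- In the cone at the base point, a point of height y has image under `M⁻¹` of height at least 1 /
  -- (M₁₀² (K² + 1) y), which exceeds `c` for y below this ε.
  obtain ⟨n, hn, h1, h2⟩ := exists_crossing hesc hc hstep hp hq hr
    (ε := 1 / (c * M 1 0 ^ 2 * (K ^ 2 + 1))) (by positivity) m
  have h3 := hm n hn
  have hy := (Q n).im_pos
  have h4 : (M 0 0 - M 1 0 * (Q n).re) ^ 2 ≤ M 1 0 ^ 2 * (K * (Q n).im) ^ 2 := by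
    have : M 0 0 - M 1 0 * (Q n).re = - (M 1 0 * ((Q n).re - M 0 0 / M 1 0)) := by
      field_simp
      ring
    rw [this, neg_sq, mul_pow]
    exact mul_le_mul_of_nonneg_left (sq_le_sq' (abs_le.1 h1).1 (abs_le.1 h1).2) hM2.le
  rw [im_sl_inv_smul, div_le_iff₀ (by positivity)] at h3
  rw [lt_div_iff₀ (by positivity)] at h2
  nlinarith

/-- An isometric image of a fixed point that is low down brings one of two distinct ideal points
close to it. -/
theorem exists_base_close {T : SL(2, ℝ)} (hT : T 1 0 ≠ 0) (z : ℍ) {δ : ℝ} (hδ : 0 < δ) :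
    ∃ ε > 0, ∀ M : SL(2, ℝ), (M • z).im < ε →
      (M 1 0 ≠ 0 ∧ |M 0 0 / M 1 0 - (M • z).re| < δ) ∨
      ((M * T) 1 0 ≠ 0 ∧ |(M * T) 0 0 / (M * T) 1 0 - (M • z).re| < δ) := by
  set B := ‖(T 1 0 : ℂ) * z - T 0 0‖
  have hz := z.im_pos
  have hz' := (T⁻¹ • z).im_pos
  -- The second bound prevents the lower left entries of `M` and `M * T` from both being less than 1
  -- in absolute value; the first then turns `sq_sub_re_le` into a distance below δ.
  refine ⟨min (δ ^ 2 * min z.im (T⁻¹ • z).im) (T 1 0 ^ 2 * z.im / (1 + B) ^ 2), by positivity,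
    fun M hM => ?_⟩
  have close : ∀ (A : SL(2, ℝ)) (v : ℍ), 1 ≤ |A 1 0| → A • v = M • z →
      (M • z).im < δ ^ 2 * v.im → A 1 0 ≠ 0 ∧ |A 0 0 / A 1 0 - (M • z).re| < δ := by
    intro A v hA hv hlt
    refine ⟨fun h => by norm_num [h] at hA, ?_⟩
    have h1 := sq_sub_re_le hA v
    rw [hv] at h1
    exact abs_lt_of_sq_lt_sq (h1.trans_lt ((div_lt_iff₀ v.im_pos).2 hlt)) hδ.le
  have hM1 : (M • z).im < δ ^ 2 * min z.im (T⁻¹ • z).im := hM.trans_le (min_le_left _ _)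
  have hM2 := hM.trans_le (min_le_right _ _)
  have hor : 1 ≤ |M 1 0| ∨ 1 ≤ |(M * T) 1 0| := by
    by_contra! hlt
    have hmul : (M * T) 1 0 = M 1 0 * T 0 0 + M 1 1 * T 1 0 := by
      simp [Matrix.mul_apply, Fin.sum_univ_two]
    -- If both lower left entries were small, this identity would bound the denominator of `M` at
    -- `z`, so that `M • z` could not be low.
    have h1 : (T 1 0 : ℂ) * ((M 1 0 : ℂ) * z + M 1 1) =
        ((M * T) 1 0 : ℝ) + (M 1 0 : ℂ) * ((T 1 0 : ℂ) * z - T 0 0) := by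
      rw [hmul]
      push_cast
      ring
    have h2 : ‖(T 1 0 : ℂ) * ((M 1 0 : ℂ) * z + M 1 1)‖ < 1 + B := by
      rw [h1]
      refine (norm_add_le _ _).trans_lt ?_
      rw [norm_mul, Complex.norm_real, Complex.norm_real, Real.norm_eq_abs, Real.norm_eq_abs]
      refine add_lt_add_of_lt_of_le hlt.2 (mul_le_of_le_one_left (norm_nonneg _) hlt.1.le)
    have h3 : T 1 0 ^ 2 * Complex.normSq ((M 1 0 : ℂ) * z + M 1 1) < (1 + B) ^ 2 := by
      have := pow_lt_pow_left₀ h2 (norm_nonneg _) two_ne_zero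
      rwa [← Complex.normSq_eq_norm_sq, map_mul, Complex.normSq_ofReal, ← sq] at this
    have hpos := Complex.normSq_pos.2 (sl_denom_ne_zero M z)
    rw [im_sl_smul, div_lt_div_iff₀ hpos (by positivity)] at hM2
    nlinarith
  rcases hor with h | h
  · exact Or.inl (close M z h rfl (hM1.trans_le (by gcongr; exact min_le_left _ _)))
  · refine Or.inr (close (M * T) (T⁻¹ • z) h ?_ (hM1.trans_le (by gcongr; exact min_le_right _ _)))
    rw [mul_smul, smul_inv_smul]

/-- A path whose orbit structure misses horoballs based at two distinct ideal points, at every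
stage, does not oscillate. -/
theorem not_oscillates (hesc : Tendsto (fun n => dist (Q n) w) atTop atTop)
    (hc : ∀ n, (Q n).im ≤ c) (hstep : ∀ n, dist (Q (n + 1)) (Q n) ≤ C) (hpq : p < q)
    (hp : ∃ᶠ n in atTop, (Q n).re < p) (hq : ∃ᶠ n in atTop, q < (Q n).re)
    {M : ℕ → SL(2, ℝ)} {T : SL(2, ℝ)} (hT : T 1 0 ≠ 0) {z : ℍ} (hQ : ∀ m, Q m = M m • z)
    (h1 : ∀ m, ∀ n ≥ m, ((M m)⁻¹ • Q n).im ≤ c)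
    (h2 : ∀ m, ∀ n ≥ m, ((M m * T)⁻¹ • Q n).im ≤ c) : False := by
  -- A quarter of the interval is allowed between base point and path, another quarter between path
  -- and midpoint; together they stay inside the interval.
  obtain ⟨ε, hε, hclose⟩ := exists_base_close hT z (δ := (q - p) / 4) (by linarith)
  have hK : 0 ≤ Real.exp C - 1 := by
    have := Real.add_one_le_exp C
    have := dist_nonneg.trans (hstep 0)
    linarith
  obtain ⟨m, -, h3, h4⟩ := exists_crossing hesc hc hstep hp hq (r := (p + q) / 2)
    ⟨by linarith, by linarith⟩ (ε := min ε ((q - p) / 4 / (Real.exp C - 1 + 1)))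
    (lt_min hε (by have : 0 < q - p := sub_pos.2 hpq
                   positivity)) 0
  have h5 : (Real.exp C - 1) * (Q m).im < (q - p) / 4 := by
    have h := h4.trans_le (min_le_right _ _)
    rw [lt_div_iff₀ (by linarith)] at h
    nlinarith [(Q m).im_pos]
  have hmem : ∀ x : ℝ, |x - (Q m).re| < (q - p) / 4 → x ∈ Ioo p q := by
    intro x hx
    have := abs_lt.1 hx
    have := abs_le.1 h3
    constructor <;> linarith
  have h6 := h4.trans_le (min_le_left _ _)
  rw [hQ m] at h6
  rcases hclose (M m) h6 with ⟨hne, hlt⟩ | ⟨hne, hlt⟩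
  · exact notMem_Ioo_of_im_inv_smul_le hesc hc hstep hp hq hne (h1 m) (hmem _ (by rwa [hQ m]))
  · exact notMem_Ioo_of_im_inv_smul_le hesc hc hstep hp hq hne (h2 m) (hmem _ (by rwa [hQ m]))

end Path

/-! ### Convergence to ideal points in the extended plane. -/

theorem continuous_planePoint : Continuous planePoint :=
  OnePoint.continuous_coe.comp UpperHalfPlane.continuous_coe

theorem idealPoint_coe (x : ℝ) : idealPoint (x : OnePoint ℝ) = ((x : ℂ) : OnePoint ℂ) := rfl

theorem idealPoint_infty : idealPoint OnePoint.infty = OnePoint.infty := rfl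

theorem planePoint_ne_idealPoint (z : ℍ) (x : OnePoint ℝ) : planePoint z ≠ idealPoint x := by
  induction x using OnePoint.rec with
  | infty => exact OnePoint.coe_ne_infty _
  | coe x =>
    intro h
    rw [planePoint, idealPoint_coe, OnePoint.coe_eq_coe] at h
    have := congrArg Complex.im h
    exact z.im_pos.ne' (by simpa using this)

theorem idealPoint_injective : Function.Injective idealPoint := by
  intro x y h
  induction x using OnePoint.rec with
  | infty =>
    induction y using OnePoint.rec with
    | infty => rfl
    | coe y => exact absurd h.symm (OnePoint.coe_ne_infty _)
  | coe x =>
    induction y using OnePoint.rec with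
    | infty => exact absurd h (OnePoint.coe_ne_infty _)
    | coe y =>
      rw [idealPoint_coe, idealPoint_coe, OnePoint.coe_eq_coe, Complex.ofReal_inj] at h
      rw [h]

section Filter

variable {ι : Type*} {l : Filter ι} {u : ι → ℍ}

theorem tendsto_cocompact_of_tendsto_idealPoint {x : OnePoint ℝ}
    (h : Tendsto (fun n => planePoint (u n)) l (𝓝 (idealPoint x))) :
    Tendsto u l (cocompact ℍ) := by
  rw [(hasBasis_cocompact).tendsto_right_iff]
  intro K hK
  have hK' : IsClosed (planePoint '' K) := (hK.image continuous_planePoint).isClosed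
  have : (planePoint '' K)ᶜ ∈ 𝓝 (idealPoint x) := by
    refine hK'.isOpen_compl.mem_nhds ?_
    rintro ⟨z, -, hz⟩
    exact planePoint_ne_idealPoint z x hz
  filter_upwards [h this] with n hn hnK
  exact hn ⟨_, hnK, rfl⟩

theorem tendsto_norm_of_le_im (hu : Tendsto u l (cocompact ℍ)) {a : ℝ} (ha : 0 < a)
    (him : ∀ᶠ n in l, a ≤ (u n).im) : Tendsto (fun n => ‖(u n : ℂ)‖) l atTop := by
  rw [tendsto_atTop]
  intro R
  have hd := (tendsto_dist_right_cocompact_atTop I).comp hu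
  filter_upwards [him, hd.eventually_gt_atTop ((R + 1) / √(a * 1))] with n h1 h2
  by_contra! hlt
  refine h2.not_ge ((dist_le_dist_coe_div_sqrt _ _).trans ?_)
  have h3 : dist (u n : ℂ) (I : ℍ) ≤ R + 1 := by
    rw [dist_eq_norm]
    refine (norm_sub_le _ _).trans ?_
    simpa using hlt.le
  rw [I_im]
  have := dist_nonneg.trans h3
  gcongr

theorem tendsto_planePoint_infty (hu : Tendsto (fun n => ‖(u n : ℂ)‖) l atTop) :
    Tendsto (fun n => planePoint (u n)) l (𝓝 (idealPoint OnePoint.infty)) := by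
  rw [idealPoint_infty]
  refine OnePoint.tendsto_coe_infty.comp ?_
  rw [coclosedCompact_eq_cocompact, ← Metric.cobounded_eq_cocompact]
  exact tendsto_norm_atTop_iff_cobounded.1 hu

theorem tendsto_planePoint_coe {x : ℝ} (hu : Tendsto (fun n => (u n : ℂ)) l (𝓝 (x : ℂ))) :
    Tendsto (fun n => planePoint (u n)) l (𝓝 (idealPoint x)) :=
  (OnePoint.continuous_coe.tendsto (x : ℂ)).comp hu

/-- The image of infinity under an isometry. -/
theorem exists_idealPoint_of_norm (A : SL(2, ℝ)) :
    -- The point is fixed before the filter, so that it serves both sequences and filters on ℍ.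
    ∃ p : OnePoint ℝ, ∀ {ι : Type} {l : Filter ι} {u : ι → ℍ},
      Tendsto (fun n => ‖(u n : ℂ)‖) l atTop →
      Tendsto (fun n => planePoint (A • u n)) l (𝓝 (idealPoint p)) := by
  have hdet : (A 0 0 : ℂ) * A 1 1 - A 0 1 * A 1 0 = 1 := by exact_mod_cast sl_det A
  by_cases hc : A 1 0 = 0
  · refine ⟨OnePoint.infty, fun {ι l u} hu => tendsto_planePoint_infty ?_⟩
    simp only [hc, Complex.ofReal_zero, mul_zero, sub_zero] at hdet
    have ha : (A 0 0 : ℂ) ≠ 0 := fun h => by simp [h] at hdet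
    have hd : (A 1 1 : ℂ) ≠ 0 := fun h => by simp [h] at hdet
    have : Tendsto (fun n => (A 0 0 / A 1 1 : ℂ) * (u n : ℂ) + A 0 1 / A 1 1) l
        (Bornology.cobounded ℂ) := by
      refine tendsto_add_const_cobounded _ |>.comp ?_
      exact (tendsto_mul_left_cobounded (div_ne_zero ha hd)).comp
        (tendsto_norm_atTop_iff_cobounded.1 hu)
    refine (tendsto_norm_atTop_iff_cobounded.2 this).congr fun n => ?_
    rw [coe_sl_smul, hc]
    simp only [Complex.ofReal_zero, zero_mul, zero_add]
    congr 1
    ring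
  · have hc' : (A 1 0 : ℂ) ≠ 0 := by exact_mod_cast hc
    refine ⟨((A 0 0 / A 1 0 : ℝ) : OnePoint ℝ), fun {ι l u} hu => tendsto_planePoint_coe ?_⟩
    have h1 : Tendsto (fun n => (A 1 0 : ℂ) * (u n : ℂ) + A 1 1) l (Bornology.cobounded ℂ) :=
      tendsto_add_const_cobounded _ |>.comp
        ((tendsto_mul_left_cobounded hc').comp (tendsto_norm_atTop_iff_cobounded.1 hu))
    have h2 := ((tendsto_inv₀_cobounded.comp h1).const_mul ((A 1 0 : ℂ)⁻¹)).const_sub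
      ((A 0 0 / A 1 0 : ℝ) : ℂ)
    rw [mul_zero, sub_zero] at h2
    refine h2.congr fun n => ?_
    have hd := sl_denom_ne_zero A (u n)
    rw [coe_sl_smul, Function.comp]
    push_cast
    field_simp
    linear_combination hdet

theorem exists_tendsto_idealPoint {u : ℕ → ℍ} {x : ℝ} (A : SL(2, ℝ))
    (hu : Tendsto (fun n => (u n : ℂ)) atTop (𝓝 (x : ℂ))) :
    ∃ p : OnePoint ℝ, Tendsto (fun n => planePoint (A • u n)) atTop (𝓝 (idealPoint p)) := by
  obtain ⟨p, hp⟩ := exists_idealPoint_of_norm (A * (toInfty x)⁻¹)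
  refine ⟨p, (hp (tendsto_norm_toInfty_smul hu)).congr fun n => ?_⟩
  rw [mul_smul, inv_smul_smul]

end Filter

/-! ### The backward limit set when the base of the missed horoball is fixed. -/

theorem one_le_of_im_pow_smul_le {A : SL(2, ℝ)} {lam c : ℝ} (hlam : 0 < lam)
    (h : ∀ z : ℍ, (A⁻¹ • z).im = lam * z.im) {z : ℍ} (hz : ∀ n : ℕ, (A ^ n • z).im ≤ c) :
    1 ≤ lam := by
  by_contra! hlt
  have hpow : ∀ n : ℕ, z.im = lam ^ n * (A ^ n • z).im := by
    intro n
    induction n with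
    | zero => simp
    | succ n ih =>
      rw [ih, pow_succ lam, mul_assoc, ← h, pow_succ', mul_smul, inv_smul_smul]
  have h1 : Tendsto (fun n : ℕ => lam ^ n * c) atTop (𝓝 (0 * c)) :=
    (tendsto_pow_atTop_nhds_zero_of_lt_one hlam.le hlt).mul_const c
  have h2 : z.im ≤ 0 * c := ge_of_tendsto' h1 fun n => by
    rw [hpow n]
    exact mul_le_mul_of_nonneg_left (hz n) (by positivity)
  rw [zero_mul] at h2
  exact h2.not_gt z.im_pos

variable {S : Subsemigroup MoebiusGroup} {w : ℍ} {k : SL(2, ℝ)} {c : ℝ}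

/-- Conjugated by `k`, elements of `S` are affine and scale heights. Powers of an element keep the
orbit below `c`, so its scale factor is at most 1. -/
theorem le_im_inv_smul (hk : ∀ g ∈ withOne S, (k • g • w).im ≤ c)
    (haff : ∀ B : SL(2, ℝ), (B : MoebiusGroup) ∈ S → (k * B⁻¹ * k⁻¹) 1 0 = 0)
    {g : MoebiusGroup} (hg : g ∈ S) (z : ℍ) : (k • z).im ≤ (k • g⁻¹ • z).im := by
  obtain ⟨B, rfl⟩ := exists_lift g
  set A := k * B * k⁻¹ with hA
  have hAinv : A⁻¹ = k * B⁻¹ * k⁻¹ := by rw [hA]; group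
  have h0 : (A⁻¹) 1 0 = 0 := by rw [hAinv]; exact haff B hg
  have hd : (A⁻¹) 1 1 ≠ 0 := fun h => by
    have := sl_det A⁻¹
    simp [h0, h] at this
  have hscale : ∀ z : ℍ, (A⁻¹ • z).im = (((A⁻¹) 1 1) ^ 2)⁻¹ * z.im := by
    intro z
    rw [im_sl_smul, h0]
    simp only [Complex.ofReal_zero, zero_mul, zero_add, Complex.normSq_ofReal]
    rw [← sq, div_eq_inv_mul]
  have h1 := one_le_of_im_pow_smul_le (by positivity) hscale (z := k • w) (c := c) (fun n => by
    have : A ^ n • k • w = k • ((B : MoebiusGroup) ^ n) • w := by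
      have : ((B : MoebiusGroup) ^ n) = ((B ^ n : SL(2, ℝ)) : MoebiusGroup) := rfl
      rw [this, mk_smul, hA, conj_pow, mul_smul, mul_smul, inv_smul_smul]
    rw [this]
    exact hk _ (pow_mem (mem_withOne_of_mem hg) n))
  have h2 : k • ((B : MoebiusGroup)⁻¹) • z = A⁻¹ • k • z := by
    have : ((B : MoebiusGroup)⁻¹) = ((B⁻¹ : SL(2, ℝ)) : MoebiusGroup) := rfl
    rw [this, mk_smul, hAinv, mul_smul, mul_smul, inv_smul_smul]
  rw [h2, hscale]
  exact le_mul_of_one_le_left (k • z).im_pos.le h1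

theorem smul_tendsto_cocompact {ι : Type*} {l : Filter ι} {u : ι → ℍ} (k : SL(2, ℝ))
    (hu : Tendsto u l (cocompact ℍ)) : Tendsto (fun n => k • u n) l (cocompact ℍ) :=
  (Homeomorph.smul k).isClosedEmbedding.tendsto_cocompact.comp hu

/-- If the orbit misses a horoball at an ideal point fixed by the semigroup, then this ideal point
is the only backward limit point. -/
theorem encard_backwardLimitSet_eq_one (hk : ∀ g ∈ withOne S, (k • g • w).im ≤ c)
    (haff : ∀ B : SL(2, ℝ), (B : MoebiusGroup) ∈ S → (k * B⁻¹ * k⁻¹) 1 0 = 0)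
    {F : ℕ → MoebiusGroup} (hF : ∀ᶠ n in atTop, F n ∈ S)
    (hesc : Tendsto (fun n => F n • w) atTop (cocompact ℍ)) :
    (backwardLimitSet (S : Set MoebiusGroup)).encard = 1 := by
  obtain ⟨p, hp⟩ := exists_idealPoint_of_norm k⁻¹
  rw [encard_eq_one]
  refine ⟨p, eq_singleton_iff_unique_mem.2 ⟨⟨w, ?_⟩, ?_⟩⟩
  -- The inverses escape as fast as the `F n`, with heights bounded below after applying `k`, so
  -- they can only tend to infinity.
  · have h1 : Tendsto (fun n => (F n)⁻¹ • w) atTop (cocompact ℍ) := by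
      refine tendsto_cocompact_of_tendsto_dist_comp_atTop w ?_
      simp_rw [dist_inv_smul_left, dist_comm w]
      exact (tendsto_dist_right_cocompact_atTop w).comp hesc
    have h2 := tendsto_norm_of_le_im (smul_tendsto_cocompact k h1) (k • w).im_pos
      (hF.mono fun n hn => le_im_inv_smul hk haff hn w)
    have h3 := hp h2
    simp_rw [inv_smul_smul] at h3
    rw [accPt_iff_frequently]
    refine h3.frequently (hF.mono fun n hn => ⟨planePoint_ne_idealPoint _ _, (F n)⁻¹, ?_, rfl⟩).frequently
    simpa using hn
  · rintro x ⟨z, hx⟩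
    set Y : Set ℍ := (fun g : MoebiusGroup => g • z) '' (S : Set MoebiusGroup)⁻¹
    -- This filter stands in for a sequence in the backward orbit tending to `x`.
    set l : Filter ℍ := comap planePoint (𝓝 (idealPoint x)) ⊓ 𝓟 Y
    have hl : l.NeBot := by
      rw [← frequently_mem_iff_neBot, frequently_comap]
      refine (accPt_iff_frequently.1 hx).mono ?_
      rintro _ ⟨-, g, hg, rfl⟩
      exact ⟨g • z, rfl, g, hg, rfl⟩
    have h1 : Tendsto planePoint l (𝓝 (idealPoint x)) := tendsto_comap.mono_left inf_le_left
    have h2 : ∀ᶠ y in l, (k • z).im ≤ (k • y).im := by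
      filter_upwards [show Y ∈ l from mem_inf_of_right (mem_principal_self Y)]
      rintro _ ⟨g, hg, rfl⟩
      simpa using le_im_inv_smul hk haff hg z
    have h3 := tendsto_norm_of_le_im
      (smul_tendsto_cocompact k (tendsto_cocompact_of_tendsto_idealPoint (u := id) h1))
      (k • z).im_pos h2
    have h4 := hp h3
    simp_rw [inv_smul_smul] at h4
    exact idealPoint_injective (tendsto_nhds_unique h1 h4)

/-! ### Escaping composition sequences converge when the semigroup is not cocompact Fuchsian. -/

theorem tendsto_cocompact_of_not_mapClusterPt {u : ℕ → ℍ}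
    (h : ∀ z, ¬ MapClusterPt z atTop u) : Tendsto u atTop (cocompact ℍ) := by
  rw [hasBasis_cocompact.tendsto_right_iff]
  intro K hK
  by_contra hf
  obtain ⟨z, -, hz⟩ := hK.exists_mapClusterPt_of_frequently (l := atTop) (f := u)
    ((not_eventually.1 hf).mono fun n hn => not_not.1 hn)
  exact h z hz

theorem exists_dist_smul_le {𝓕 : Set MoebiusGroup} (h𝓕 : 𝓕.Finite) (w : ℍ) :
    ∃ C, 0 ≤ C ∧ ∀ f ∈ 𝓕, dist (f • w) w ≤ C := by
  obtain ⟨C, hC⟩ := (h𝓕.image fun f => dist (f • w) w).bddAbove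
  exact ⟨max C 0, le_max_right _ _, fun f hf => (hC ⟨f, hf, rfl⟩).trans (le_max_left _ _)⟩

namespace IsCompositionSequence

variable {𝓕 : Set MoebiusGroup} {F : ℕ → MoebiusGroup}

theorem inv_mul_mem (hF : IsCompositionSequence 𝓕 F) {m n : ℕ} (h : m ≤ n) :
    (F m)⁻¹ * F n ∈ withOne (Subsemigroup.closure 𝓕) := by
  induction n, h using Nat.le_induction with
  | base => simp [one_mem]
  | succ n hn ih =>
    obtain ⟨f, hf, he⟩ := hF.2 n
    rw [he, ← mul_assoc]
    exact mul_mem ih (mem_withOne_of_mem (Subsemigroup.subset_closure hf))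

theorem succ_mem (hF : IsCompositionSequence 𝓕 F) (n : ℕ) :
    F (n + 1) ∈ Subsemigroup.closure 𝓕 := by
  obtain ⟨f, hf, he⟩ := hF.2 n
  have := hF.inv_mul_mem (Nat.zero_le n)
  rw [hF.1, inv_one, one_mul] at this
  rw [he]
  exact mul_mem_of_withOne_mem this (Subsemigroup.subset_closure hf)

theorem dist_succ_le (hF : IsCompositionSequence 𝓕 F) {w : ℍ} {C : ℝ}
    (hC : ∀ f ∈ 𝓕, dist (f • w) w ≤ C) (n : ℕ) : dist (F (n + 1) • w) (F n • w) ≤ C := by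
  obtain ⟨f, hf, he⟩ := hF.2 n
  rw [he, mul_smul, dist_smul]
  exact hC f hf

end IsCompositionSequence

theorem convergesIdeally_of_isEscaping {𝓕 : Set MoebiusGroup} (h𝓕 : 𝓕.Finite)
    (hsemi : IsSemidiscrete (Subsemigroup.closure 𝓕))
    (hΛ : (backwardLimitSet (Subsemigroup.closure 𝓕 : Set MoebiusGroup)).encard ≠ 1)
    (hgrp : ¬ IsCocompactFuchsianGroup (Subsemigroup.closure 𝓕)) {F : ℕ → MoebiusGroup}
    (hF : IsCompositionSequence 𝓕 F) (hesc : IsEscaping F) : ConvergesIdeally F := by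
  have hesc' := hesc
  obtain ⟨w, hw⟩ := hesc'
  have hco := tendsto_cocompact_of_not_mapClusterPt hw
  obtain ⟨k, c, hk⟩ := exists_horoball (w := w) fun D hD =>
    hgrp (isCocompactFuchsianGroup_of_isOrbitDense hsemi ⟨_, hF.succ_mem 0⟩ hD)
  -- Some inverse moves the base point of the horoball; this supplies the second family of missed
  -- horoballs.
  obtain ⟨B₀, hB₀, hT⟩ : ∃ B : SL(2, ℝ), (B : MoebiusGroup) ∈ Subsemigroup.closure 𝓕 ∧
      (k * B⁻¹ * k⁻¹) 1 0 ≠ 0 := by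
    by_contra! haff
    refine hΛ (encard_backwardLimitSet_eq_one hk haff (F := F) ?_ hco)
    filter_upwards [eventually_ge_atTop 1] with n hn
    obtain ⟨m, rfl⟩ := Nat.exists_eq_add_of_le' hn
    exact hF.succ_mem m
  obtain ⟨C, -, hC⟩ := exists_dist_smul_le h𝓕 w
  choose B hB using fun n => exists_lift (F n)
  set Q : ℕ → ℍ := fun n => k • F n • w
  have hQesc : Tendsto (fun n => dist (Q n) I) atTop atTop :=
    (tendsto_dist_right_cocompact_atTop I).comp (smul_tendsto_cocompact k hco)
  have hmem : ∀ {m n : ℕ}, m ≤ n → (F m)⁻¹ * F n ∈ withOne (Subsemigroup.closure 𝓕) :=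
    fun h => hF.inv_mul_mem h
  have hQc : ∀ n, (Q n).im ≤ c := fun n => by
    have := hk _ (hmem (Nat.zero_le n))
    rwa [hF.1, inv_one, one_mul] at this
  have hback : ∀ n, F n • w = k⁻¹ • Q n := fun n => (inv_smul_smul k _).symm
  rcases tendsto_or_oscillates hQesc hQc with ⟨x, hx⟩ | hx | ⟨p, q, hpq, hp, hq⟩
  · obtain ⟨y, hy⟩ := exists_tendsto_idealPoint k⁻¹ hx
    exact ⟨y, hesc, w, by simpa only [hback] using hy⟩
  · obtain ⟨y, hy⟩ := exists_idealPoint_of_norm k⁻¹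
    exact ⟨y, hesc, w, by simpa only [hback] using hy hx⟩
  · exfalso
    have hstep : ∀ n, dist (Q (n + 1)) (Q n) ≤ C := fun n => by
      rw [dist_smul]
      exact hF.dist_succ_le hC n
    have hB' : ∀ n (z : ℍ), F n • z = B n • z := fun n z => by rw [← hB n, mk_smul]
    refine not_oscillates hQesc hQc hstep hpq hp hq (M := fun m => k * B m * k⁻¹) hT (z := k • w)
      (fun m => ?_) (fun m n hmn => ?_) (fun m n hmn => ?_)
    · simp only [Q, mul_smul, inv_smul_smul, hB']
    · have h1 := hk _ (hmem hmn)
      have h2 : (k * B m * k⁻¹)⁻¹ • Q n = k • ((F m)⁻¹ * F n) • w := by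
        rw [← hB m, ← hB n, ← QuotientGroup.mk_inv, ← QuotientGroup.mk_mul, mk_smul]
        simp only [Q, hB', ← mul_smul]
        congr 1
        group
      rwa [h2]
    · have h1 := hk _ (mul_mem (mem_withOne_of_mem hB₀) (hmem hmn))
      have h2 : (k * B m * k⁻¹ * (k * B₀⁻¹ * k⁻¹))⁻¹ • Q n =
          k • ((B₀ : MoebiusGroup) * ((F m)⁻¹ * F n)) • w := by
        rw [← hB m, ← hB n, ← QuotientGroup.mk_inv, ← QuotientGroup.mk_mul,
          ← QuotientGroup.mk_mul, mk_smul]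
        simp only [Q, hB', ← mul_smul]
        congr 1
        group
      rwa [h2]

/-! ### A divergent composition sequence in a cocompact group. -/

theorem exists_dist_le_of_compactSpace (G : Subgroup MoebiusGroup)
    [CompactSpace (Quotient (MulAction.orbitRel G ℍ))] (w : ℍ) :
    ∃ D, 0 ≤ D ∧ ∀ z : ℍ, ∃ g ∈ G, dist z (g • w) ≤ D := by
  have : ContinuousConstSMul G ℍ := ⟨fun g => (isometry_smul ℍ (g : MoebiusGroup)).continuous⟩
  have hopen : IsOpenMap (Quotient.mk'' : ℍ → Quotient (MulAction.orbitRel G ℍ)) :=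
    isOpenMap_quotient_mk'_mul
  obtain ⟨n, hn⟩ := isCompact_univ.elim_directed_cover
    (fun n : ℕ => (Quotient.mk'' : ℍ → Quotient (MulAction.orbitRel G ℍ)) '' Metric.ball w n)
    (fun n => hopen _ Metric.isOpen_ball)
    (by
      intro q _
      induction q using Quotient.inductionOn' with
      | h z =>
        obtain ⟨n, hn⟩ := exists_nat_gt (dist z w)
        exact mem_iUnion.2 ⟨n, z, hn, rfl⟩)
    (Monotone.directed_le fun m n hmn => image_mono (Metric.ball_subset_ball (by exact_mod_cast hmn)))
  refine ⟨n, n.cast_nonneg, fun z => ?_⟩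
  obtain ⟨y, hy, he⟩ := hn (mem_univ (Quotient.mk'' z))
  obtain ⟨g, hg⟩ := Quotient.exact' he
  refine ⟨g⁻¹, inv_mem g.2, ?_⟩
  have hg' : (g : MoebiusGroup) • z = y := hg
  rw [dist_comm, dist_inv_smul_left, hg', dist_comm]
  exact (Metric.mem_ball.1 hy).le

theorem finite_setOf_dist_smul_le {S : Subsemigroup MoebiusGroup} (hS : IsSemidiscrete S)
    (hinv : ∀ g ∈ S, g⁻¹ ∈ S) (w : ℍ) (R : ℝ) : {g | g ∈ S ∧ dist (g • w) w ≤ R}.Finite := by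
  by_contra hinf
  obtain ⟨U, hU, hU1⟩ := hS.exists_nhds
  let e := Set.Infinite.natEmbedding _ hinf
  obtain ⟨k, l, hkl, hmem⟩ := exists_lt_inv_mul_mem (isCompact_setOf_dist_smul_le w R)
    (h := fun n => (e n : MoebiusGroup)) (fun n => (e n).2.2) hU
  have h1 := hU1 _ hmem (S.mul_mem (hinv _ (e k).2.1) (e l).2.1)
  exact hkl.ne (e.injective (Subtype.ext (inv_mul_eq_one.1 h1)))

theorem exists_list_of_mem_closure {M : Type*} [Monoid M] {s : Set M} {g : M}
    (hg : g ∈ Subsemigroup.closure s) : ∃ l : List M, l ≠ [] ∧ (∀ f ∈ l, f ∈ s) ∧ l.prod = g := by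
  induction hg using Subsemigroup.closure_induction with
  | mem x hx => exact ⟨[x], by simp, by simpa using hx, by simp⟩
  | mul x y _ _ hx hy =>
    obtain ⟨l₁, h₁, h₁', rfl⟩ := hx
    obtain ⟨l₂, h₂, h₂', rfl⟩ := hy
    refine ⟨l₁ ++ l₂, by simp [h₁], fun f hf => ?_, by simp⟩
    rcases List.mem_append.1 hf with hf | hf
    · exact h₁' f hf
    · exact h₂' f hf

theorem dist_list_prod_smul_le {𝓕 : Set MoebiusGroup} {w : ℍ} {C : ℝ}
    (hC : ∀ f ∈ 𝓕, dist (f • w) w ≤ C) {l : List MoebiusGroup} (hl : ∀ f ∈ l, f ∈ 𝓕) :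
    dist (l.prod • w) w ≤ l.length * C := by
  induction l with
  | nil => simp
  | cons f l ih =>
    have h1 := ih fun g hg => hl g (List.mem_cons_of_mem _ hg)
    have h2 := hC f (hl f List.mem_cons_self)
    have h3 := dist_triangle ((f * l.prod) • w) (f • w) w
    rw [mul_smul, dist_smul] at h3
    rw [List.prod_cons, List.length_cons, mul_smul]
    push_cast
    linarith

/-- One step in spelling out an infinite concatenation of words: the state consists of the number
of words begun so far and the remaining part of the current word. -/
def spell {M : Type*} (W : ℕ → List M) : ℕ × List M → ℕ × List M
  | (k, []) => (k + 1, (W k).tail)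
  | (k, _ :: l) => (k, l)

/-- Concatenating words of bounded length yields a composition sequence. -/
theorem exists_isCompositionSequence {𝓕 : Set MoebiusGroup} {g : ℕ → MoebiusGroup} (hg0 : g 0 = 1)
    {L : ℕ} (hg : ∀ k, ∃ l : List MoebiusGroup, l ≠ [] ∧ (∀ f ∈ l, f ∈ 𝓕) ∧ l.length ≤ L ∧
      l.prod = (g k)⁻¹ * g (k + 1)) :
    ∃ (F : ℕ → MoebiusGroup) (κ : ℕ → ℕ), IsCompositionSequence 𝓕 F ∧ Tendsto κ atTop atTop ∧
      (∀ k, ∃ n ≥ k, κ n = k) ∧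
      ∀ n, ∃ l : List MoebiusGroup, (∀ f ∈ l, f ∈ 𝓕) ∧ l.length ≤ L ∧
        F n * l.prod = g (κ n) := by
  choose W hne h𝓕 hlen hprod using hg
  let st : ℕ → ℕ × List MoebiusGroup := fun n => (spell W)^[n] (0, [])
  have hst : ∀ n, st (n + 1) = spell W (st n) := fun n => Function.iterate_succ_apply' _ _ _
  have hW : ∀ k, ∃ f l, W k = f :: l := fun k => List.exists_cons_of_ne_nil (hne k)
  -- The third clause forces the word counter to infinity; the fourth yields `n ≥ k` when the
  -- counter equals `k`.
  have hinv : ∀ n, (∀ f ∈ (st n).2, f ∈ 𝓕) ∧ (st n).2.length ≤ L ∧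
      n + (st n).2.length ≤ (st n).1 * L ∧ (st n).1 ≤ n := by
    intro n
    induction n with
    | zero => simp [st]
    | succ n ih =>
      rw [hst]
      obtain ⟨h1, h2, h3, h4⟩ := ih
      rcases hs : st n with ⟨k, _ | ⟨f, l⟩⟩
      · obtain ⟨f, l, he⟩ := hW k
        have hl := hlen k
        have hf := h𝓕 k
        rw [he] at hl hf
        simp only [hs, List.length_cons, List.length_nil] at h3 h4 hl
        refine ⟨?_, ?_, ?_, ?_⟩
        · simp only [spell, he, List.tail_cons]
          exact fun f' hf' => hf f' (List.mem_cons_of_mem _ hf')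
        · simp only [spell, he, List.tail_cons]
          omega
        · simp only [spell, he, List.tail_cons, Nat.succ_mul]
          omega
        · simp only [spell]
          omega
      · simp only [hs, List.length_cons] at h1 h2 h3 h4
        simp only [spell]
        refine ⟨fun f' hf' => h1 f' (List.mem_cons_of_mem _ hf'), by omega, by omega, by omega⟩
  have hstep : ∀ n, (st (n + 1)).1 ≤ (st n).1 + 1 := by
    intro n
    rw [hst]
    rcases st n with ⟨k, _ | ⟨f, l⟩⟩ <;> simp [spell]
  have htend : Tendsto (fun n => (st n).1) atTop atTop := by
    rw [tendsto_atTop]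
    intro b
    filter_upwards [eventually_ge_atTop (b * L + 1)] with n hn
    by_contra! hlt
    have := (hinv n).2.2.1
    have := Nat.mul_le_mul_right L hlt.le
    omega
  -- The current product is the target `g k` with the unread remainder of the word removed.
  refine ⟨fun n => g (st n).1 * ((st n).2.prod)⁻¹, fun n => (st n).1, ⟨?_, fun n => ?_⟩, htend,
    fun k => ?_, fun n => ⟨(st n).2, (hinv n).1, (hinv n).2.1, by simp⟩⟩
  · simp [st, hg0]
  · have h1 := (hinv n).1
    simp only [hst]
    rcases hs : st n with ⟨k, _ | ⟨f, l⟩⟩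
    · obtain ⟨f, l, he⟩ := hW k
      refine ⟨f, h𝓕 k f (by simp [he]), ?_⟩
      have := hprod k
      rw [he, List.prod_cons] at this
      simp only [spell, he, List.tail_cons, List.prod_nil, inv_one, mul_one]
      rw [← eq_inv_mul_iff_mul_eq.1 this]
      group
    · refine ⟨f, h1 f (by simp [hs]), ?_⟩
      simp only [spell, List.prod_cons]
      group
  -- The counter grows by at most one at a time, so no value is skipped.
  · have hex : ∃ n, k ≤ (st n).1 := (htend.eventually_ge_atTop k).exists
    classical
    have h1 := Nat.find_spec hex
    refine ⟨Nat.find hex, h1.trans (hinv _).2.2.2, le_antisymm ?_ h1⟩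
    rcases hn : Nat.find hex with _ | n
    · simp [st]
    · have h2 : ¬ k ≤ (st n).1 := Nat.find_min hex (by omega)
      have h3 := hstep n
      show (st (n + 1)).1 ≤ k
      omega

/-- A sequence of points descending to the real line while oscillating. -/
noncomputable def oscillation (k : ℕ) : ℍ :=
  ⟨⟨Real.sin (Real.log (k + 1)), 1 / (k + 1)⟩, by positivity⟩

theorem oscillation_re (k : ℕ) : (oscillation k).re = Real.sin (Real.log (k + 1)) := rfl

theorem oscillation_im (k : ℕ) : (oscillation k).im = 1 / (k + 1) := rfl

theorem oscillation_zero : oscillation 0 = I := by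
  apply UpperHalfPlane.ext
  apply Complex.ext
  · simp [oscillation]
  · simp [oscillation]

/-- The Euclidean displacement is at most 2 / (k + 1), and the geometric mean of the two heights is
at least half of 1 / (k + 1). -/
theorem dist_oscillation_le (k : ℕ) : dist (oscillation (k + 1)) (oscillation k) ≤ 4 := by
  refine (dist_le_dist_coe_div_sqrt _ _).trans ?_
  have hk : (0 : ℝ) < (k : ℝ) + 1 := by positivity
  rw [oscillation_im, oscillation_im, div_le_iff₀ (by positivity)]
  have h1 : dist (oscillation (k + 1) : ℂ) (oscillation k) ≤ 1 / (k + 1) + 1 / (k + 1) := by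
    rw [dist_eq_norm]
    refine (Complex.norm_le_abs_re_add_abs_im _).trans (add_le_add ?_ ?_)
    · rw [Complex.sub_re, coe_re, coe_re, oscillation_re, oscillation_re]
      refine (Real.abs_sin_sub_sin_le _ _).trans ?_
      rw [← Real.log_div (by positivity) (by positivity), abs_of_nonneg]
      · refine (Real.log_le_sub_one_of_pos (by positivity)).trans (le_of_eq ?_)
        push_cast
        field_simp
        ring
      · apply Real.log_nonneg
        rw [le_div_iff₀ hk]
        push_cast
        linarith
    · rw [Complex.sub_im, coe_im, coe_im, oscillation_im, oscillation_im, abs_sub_comm, abs_of_nonneg]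
      · have : (0 : ℝ) ≤ 1 / (((k + 1 : ℕ) : ℝ) + 1) := by positivity
        linarith
      · rw [sub_nonneg]
        apply one_div_le_one_div_of_le hk
        push_cast
        linarith
  have h2 : 1 / ((k : ℝ) + 1) / 2 ≤ √(1 / (((k + 1 : ℕ) : ℝ) + 1) * (1 / ((k : ℝ) + 1))) := by
    apply Real.le_sqrt_of_sq_le
    rw [div_pow, sq, mul_div_assoc, mul_comm]
    refine mul_le_mul_of_nonneg_right ?_ (by positivity)
    push_cast
    rw [div_div, div_le_div_iff₀ (by positivity) (by positivity)]
    nlinarith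
  linarith

theorem not_tendsto_sin_log (x : ℝ) :
    ¬ Tendsto (fun k : ℕ => Real.sin (Real.log (k + 1))) atTop (𝓝 x) := by
  intro h
  -- Taking the integer parts of exp (s j) transfers the limit to any real sequence tending to
  -- infinity; the multiples of 2π, and these shifted by π/2, then give the limits 0 and 1.
  have key : ∀ s : ℕ → ℝ, Tendsto s atTop atTop → Tendsto (fun j => Real.sin (s j)) atTop (𝓝 x) := by
    intro s hs
    have h1 : Tendsto (fun j => ⌊Real.exp (s j)⌋₊) atTop atTop :=
      tendsto_nat_floor_atTop.comp (Real.tendsto_exp_atTop.comp hs)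
    have h2 := h.comp h1
    have h3 : Tendsto (fun j => Real.exp (-s j)) atTop (𝓝 0) :=
      Real.tendsto_exp_atBot.comp (tendsto_neg_atTop_atBot.comp hs)
    have h4 : Tendsto (fun j => Real.sin (s j) - Real.sin (Real.log (⌊Real.exp (s j)⌋₊ + 1)))
        atTop (𝓝 0) := by
      refine squeeze_zero_norm (fun j => ?_) h3
      refine (Real.abs_sin_sub_sin_le _ _).trans ?_
      have hpos := Real.exp_pos (s j)
      have e1 : s j ≤ Real.log (⌊Real.exp (s j)⌋₊ + 1) := by
        rw [Real.le_log_iff_exp_le (by positivity)]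
        exact (Nat.lt_floor_add_one _).le
      have e2 : Real.log (⌊Real.exp (s j)⌋₊ + 1) ≤ s j + Real.exp (-s j) := by
        rw [Real.log_le_iff_le_exp (by positivity), Real.exp_add]
        have e3 := Nat.floor_le hpos.le
        have e4 := Real.add_one_le_exp (Real.exp (-s j))
        have e5 : Real.exp (s j) * Real.exp (-s j) = 1 := by rw [← Real.exp_add]; simp
        nlinarith
      rw [abs_sub_comm, abs_of_nonneg (by linarith)]
      linarith
    have := h4.add h2
    rw [zero_add] at this
    refine this.congr fun j => ?_
    simp
  have hlin : Tendsto (fun j : ℕ => (j : ℝ) * (2 * Real.pi)) atTop atTop :=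
    tendsto_natCast_atTop_atTop.atTop_mul_const (by positivity)
  have h0 := key _ hlin
  have h1 := key _ (tendsto_atTop_add_const_left _ (Real.pi / 2) hlin)
  simp only [Real.sin_add_nat_mul_two_pi, Real.sin_pi_div_two] at h1
  have h0' : ∀ j : ℕ, Real.sin (j * (2 * Real.pi)) = 0 := fun j => by
    simpa using Real.sin_add_nat_mul_two_pi 0 j
  simp only [h0'] at h0
  exact zero_ne_one ((tendsto_nhds_unique tendsto_const_nhds h0).trans
    (tendsto_nhds_unique tendsto_const_nhds h1).symm)

section Following

variable {u : ℕ → ℍ} {κ : ℕ → ℕ} {B : ℝ}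

theorem tendsto_im_zero_of_following (hκ : Tendsto κ atTop atTop)
    (hB : ∀ n, dist (u n) (oscillation (κ n)) ≤ B) : Tendsto (fun n => (u n).im) atTop (𝓝 0) := by
  have h1 : Tendsto (fun n => 1 / ((κ n : ℝ) + 1) * Real.exp B) atTop (𝓝 (0 * Real.exp B)) :=
    (tendsto_one_div_add_atTop_nhds_zero_nat.comp hκ).mul_const _
  rw [zero_mul] at h1
  refine squeeze_zero (fun n => (u n).im_pos.le) (fun n => ?_) h1
  refine (im_le_im_mul_exp_dist _ (oscillation (κ n))).trans ?_
  rw [oscillation_im]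
  gcongr
  exact hB n

theorem not_tendsto_idealPoint_of_following (hκ : Tendsto κ atTop atTop)
    (hsurj : ∀ k, ∃ n ≥ k, κ n = k) (hB : ∀ n, dist (u n) (oscillation (κ n)) ≤ B)
    (p : OnePoint ℝ) : ¬ Tendsto (fun n => planePoint (u n)) atTop (𝓝 (idealPoint p)) := by
  intro h
  have him := tendsto_im_zero_of_following hκ hB
  have hre : Tendsto (fun n => (u n).re - Real.sin (Real.log (κ n + 1))) atTop (𝓝 0) := by
    have h1 : Tendsto (fun n => (Real.exp B - 1) * (1 / ((κ n : ℝ) + 1))) atTop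
        (𝓝 ((Real.exp B - 1) * 0)) :=
      (tendsto_one_div_add_atTop_nhds_zero_nat.comp hκ).const_mul _
    rw [mul_zero] at h1
    refine squeeze_zero_norm (fun n => ?_) h1
    exact abs_re_sub_re_le (hB n)
  induction p using OnePoint.rec with
  | infty =>
    rw [idealPoint_infty] at h
    have h1 : Tendsto (fun n => (u n : ℂ)) atTop (coclosedCompact ℂ) := by
      rw [← OnePoint.comap_coe_nhds_infty, tendsto_comap_iff]
      exact h
    rw [coclosedCompact_eq_cocompact, ← Metric.cobounded_eq_cocompact,
      ← tendsto_norm_atTop_iff_cobounded] at h1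
    have e1 := hre.eventually (Metric.ball_mem_nhds 0 one_pos)
    have e2 := him.eventually (Metric.ball_mem_nhds 0 one_pos)
    obtain ⟨n, h2, h3, h4⟩ := (e1.and (e2.and (h1.eventually_gt_atTop 3))).exists
    rw [Real.dist_eq, sub_zero] at h2 h3
    have h5 := Complex.norm_le_abs_re_add_abs_im (u n : ℂ)
    rw [coe_re, coe_im] at h5
    have h6 := Real.abs_sin_le_one (Real.log (κ n + 1))
    have h7 := abs_add_le ((u n).re - Real.sin (Real.log (κ n + 1)))
      (Real.sin (Real.log (κ n + 1)))
    rw [sub_add_cancel] at h7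
    linarith
  | coe x =>
    have h1 : Tendsto (fun n => (u n : ℂ)) atTop (𝓝 (x : ℂ)) :=
      OnePoint.isOpenEmbedding_coe.tendsto_nhds_iff.2 h
    have h2 : Tendsto (fun n => (u n).re) atTop (𝓝 x) :=
      (Complex.continuous_re.tendsto (x : ℂ)).comp h1
    have h3 := h2.sub hre
    simp only [sub_sub_cancel, sub_zero] at h3
    -- Since `κ` attains every value, the whole sequence sin (log (k + 1)) would inherit a limit.
    choose n hn hκn using hsurj
    have h4 := h3.comp (tendsto_atTop_mono hn tendsto_id)
    refine not_tendsto_sin_log x (h4.congr fun k => ?_)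
    simp only [Function.comp, hκn]

end Following

theorem exists_isEscaping_not_convergesIdeally {𝓕 : Set MoebiusGroup} (h𝓕 : 𝓕.Finite)
    (hsemi : IsSemidiscrete (Subsemigroup.closure 𝓕))
    (hgrp : IsCocompactFuchsianGroup (Subsemigroup.closure 𝓕)) :
    ∃ F, IsCompositionSequence 𝓕 F ∧ IsEscaping F ∧ ¬ ConvergesIdeally F := by
  obtain ⟨G, hG, -, hcpt⟩ := hgrp
  have hGS : ∀ {g}, g ∈ G ↔ g ∈ Subsemigroup.closure 𝓕 := fun {g} => by
    rw [← SetLike.mem_coe, hG, SetLike.mem_coe]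
  obtain ⟨D, hD0, hD⟩ := exists_dist_le_of_compactSpace G I
  have hg : ∀ k, ∃ g ∈ G, dist (oscillation k) (g • I) ≤ D ∧ (k = 0 → g = 1) := by
    intro k
    by_cases hk : k = 0
    · exact ⟨1, one_mem _, by simpa [hk, oscillation_zero] using hD0, fun _ => rfl⟩
    · obtain ⟨g, hg, hd⟩ := hD (oscillation k)
      exact ⟨g, hg, hd, fun h => absurd h hk⟩
  choose g hgG hgd hg0 using hg
  -- The transition elements move `I` by at most D + 4 + D: two approximation errors and one
  -- oscillation step. Their finiteness bounds the word lengths.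
  have hfin := finite_setOf_dist_smul_le hsemi
    (fun g hg => hGS.1 (inv_mem (hGS.2 hg))) I (D + 4 + D)
  choose! word hne hword hprod using
    fun g => exists_list_of_mem_closure (s := 𝓕) (g := g)
  obtain ⟨L, hL⟩ := (hfin.image fun g => (word g).length).bddAbove
  have hstepmem : ∀ k, (g k)⁻¹ * g (k + 1) ∈ Subsemigroup.closure 𝓕 := fun k =>
    hGS.1 (mul_mem (inv_mem (hgG k)) (hgG (k + 1)))
  have hstepdist : ∀ k, dist (((g k)⁻¹ * g (k + 1)) • I) I ≤ D + 4 + D := by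
    intro k
    rw [mul_smul, dist_inv_smul_left]
    refine (dist_triangle4 _ (oscillation (k + 1)) (oscillation k) _).trans ?_
    refine add_le_add (add_le_add ?_ (dist_oscillation_le k)) (hgd k)
    rw [dist_comm]
    exact hgd (k + 1)
  obtain ⟨F, κ, hF, hκ, hsurj, hfollow⟩ := exists_isCompositionSequence (𝓕 := 𝓕) (hg0 0 rfl) (L := L)
    fun k => ⟨word _, hne _ (hstepmem k), hword _ (hstepmem k),
      hL ⟨_, ⟨hstepmem k, hstepdist k⟩, rfl⟩, hprod _ (hstepmem k)⟩
  obtain ⟨C, hC0, hC⟩ := exists_dist_smul_le h𝓕 I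
  have hFd : ∀ w n, dist (F n • w) (oscillation (κ n)) ≤ dist w I + L * C + D := by
    intro w n
    obtain ⟨l, hl, hlen, he⟩ := hfollow n
    refine (dist_triangle4 _ (F n • I) (g (κ n) • I) _).trans ?_
    refine add_le_add (add_le_add ?_ ?_) ?_
    · rw [dist_smul]
    · rw [← he, mul_smul, dist_smul, dist_comm]
      refine (dist_list_prod_smul_le hC hl).trans ?_
      gcongr
    · rw [dist_comm]
      exact hgd _
  refine ⟨F, hF, ⟨I, fun z hz => ?_⟩, ?_⟩
  · have h1 := tendsto_im_zero_of_following hκ (hFd I)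
    have h2 : MapClusterPt z.im atTop (fun n => (F n • I).im) :=
      hz.continuousAt_comp continuous_im.continuousAt
    obtain ⟨n, h3, h4⟩ := ((h2.frequently (lt_mem_nhds (half_lt_self z.im_pos))).and_eventually
      (h1.eventually (gt_mem_nhds (half_pos z.im_pos)))).exists
    exact lt_asymm h3 h4
  · rintro ⟨p, -, w, hw⟩
    exact not_tendsto_idealPoint_of_following hκ hsurj (hFd w) p hw

end MoebiusSemigroup

theorem theorem3p12 (𝓕 : Set MoebiusSemigroup.MoebiusGroup) (h𝓕 : 𝓕.Finite)
    (S : Subsemigroup MoebiusSemigroup.MoebiusGroup) (hS : S = Subsemigroup.closure 𝓕)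
    (hsemi : MoebiusSemigroup.IsSemidiscrete S)
    (hΛ : (MoebiusSemigroup.backwardLimitSet (S : Set MoebiusSemigroup.MoebiusGroup)).encard ≠ 1) :
    (∀ F : ℕ → MoebiusSemigroup.MoebiusGroup,
        MoebiusSemigroup.IsCompositionSequence 𝓕 F → MoebiusSemigroup.IsEscaping F →
          MoebiusSemigroup.ConvergesIdeally F) ↔
      ¬ MoebiusSemigroup.IsCocompactFuchsianGroup S := by
  subst hS
  constructor
  · intro h hgrp
    obtain ⟨F, hF, hesc, hconv⟩ :=
      MoebiusSemigroup.exists_isEscaping_not_convergesIdeally h𝓕 hsemi hgrp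
    exact hconv (h F hF hesc)
  · intro hgrp F hF hesc
    exact MoebiusSemigroup.convergesIdeally_of_isEscaping h𝓕 hsemi hΛ hgrp hF hesc
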